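/- Let $K\ge 3$, $n\ge 1$, and let $\rho\in\mathbb R$ satisfy $\rho^2\le \mathrm{UB}:=1-\frac1{\sqrt{K-2}}$. Let $\Sigma$ be the $K\times K$ matrix with $\Sigma_{ii}=1$ and $\Sigma_{ij}=\rho^{\min(i,j)}$ for $i\ne j$, and suppose that $\Sigma$ is positive semidefinite (so that it is a covariance matrix). For $1\le m\le K$ let $\Sigma_m$ be obtained from $\Sigma$ by exchanging the roles of arms $1$ and $m$, i.e. by swapping rows $1$ and $m$ and columns $1$ and $m$ (so $\Sigma_1=\Sigma$); problem $m$ is the $K$-armed bandit whose arms $(X_1,\dots,X_K)$ have law $\mathcal N(0,\Sigma_m)$, with samples i.i.d. over time. A strategy selects in each round $t=1,\dots,n$, on the basis of the past observations (and possibly of its own randomisation), a pair $(i_t,j_t)$ with $i_t<j_t$, observes a fresh sample of $(X_{i_t},X_{j_t})$, and after $n$ rounds returns an arm $\hat A_n$. Let $\mathbb P_m$ be the probability in problem $m$. Let $\mathcal E_i=\inf_g\mathbb E\|X-g(X_i)\|^2$, where $X\sim\mathcal N(0,\Sigma)$ and the infimum runs over measurable $g:\mathbb R\to\mathbb R^K$,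 let $\Delta_i=\mathcal E_i-\min_j\mathcal E_j$ and $H_{lb}=\sum_{i\ne1}\frac1{\Delta_i}$. Let $c_1=\frac1{1-\mathrm{UB}}$, $c_2=\frac{\rho}{1-\mathrm{UB}}$, $\tilde c=\max(3c_1,48c_2)$, let $u$ be any upper bound on the variances of the arms (all of which equal $1$, so any $u\ge1$, in particular $u=1$), and $$\tilde\epsilon_n=\tilde c\,u\,\max\Big\{\tfrac8n\log\big(12K(K-1)n\big),\ \sqrt{\tfrac8n\log\big(12K(K-1)n\big)}\Big\}.$$ Then every strategy satisfies $$\max_{1\le m\le K}\mathbb P_m\big(\hat A_n\ne m\big)\ \ge\ \frac16\exp\Big(-\frac{6nK}{H_{lb}}-\binom K2\,n\,\tilde\epsilon_n\Big).$$ (If $\rho=0$, all $\Delta_i$ vanish, $H_{lb}=+\infty$, and $6nK/H_{lb}$ is read as $0$.) -/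

import Mathlib

open MeasureTheory ProbabilityTheory

noncomputable section

namespace CorrelatedBandit

/-! ### Minimum mean-squared errors and gaps

The arms of a `K`-armed bandit are `Fin K`; the arm called `1` in the usual numbering is `0`. -/

/-- The minimum mean-squared error of arm `i`: the infimum over all (measurable) `g : ℝ → ℝᴷ` of
`E ‖X - g (X i)‖²`, where `X` has law `ν`. -/
def mmse {K : ℕ} (ν : Measure (EuclideanSpace ℝ (Fin K))) (i : Fin K) : ℝ :=
  (⨅ (g : ℝ → EuclideanSpace ℝ (Fin K)) (_ : Measurable g),
    ∫⁻ x, ENNReal.ofReal (‖x - g (x i)‖ ^ 2) ∂ν).toReal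

/-- The gap of arm `i`: its mean-squared error minus the smallest one among all arms. -/
def gap {K : ℕ} (ν : Measure (EuclideanSpace ℝ (Fin K))) (i : Fin K) : ℝ :=
  mmse ν i - ⨅ j, mmse ν j

/-! ### The problem instances -/

/-- Unit variances, and covariance `ρ ^ min(i, j)` between distinct arms `i, j ∈ {1, …, K}`
(the `+ 1` is the shift from zero-based to one-based numbering). -/
def baseCov (K : ℕ) (ρ : ℝ) : Matrix (Fin K) (Fin K) ℝ :=
  Matrix.of fun i j => if i = j then 1 else ρ ^ (min (i : ℕ) (j : ℕ) + 1)

/-- The covariance matrix of problem `m`: the first arm and arm `m` exchange their roles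
(the corresponding rows, and with them the columns, are swapped). For the first arm,
nothing changes. -/
def swapCov (K : ℕ) [NeZero K] (ρ : ℝ) (m : Fin K) : Matrix (Fin K) (Fin K) ℝ :=
  (baseCov K ρ).submatrix (Equiv.swap 0 m) (Equiv.swap 0 m)

/-- The centred Gaussian law of the arms in problem `m`. -/
def problemLaw (K : ℕ) [NeZero K] (ρ : ℝ) (m : Fin K) : Measure (EuclideanSpace ℝ (Fin K)) :=
  multivariateGaussian 0 (swapCov K ρ m)

/-- The complexity `∑_{i ≠ 1} 1 / Δ_i` of the original problem. -/
def Hlb (K : ℕ) [NeZero K] (ρ : ℝ) : ℝ :=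
  ∑ i ∈ Finset.univ.filter (fun i : Fin K => i ≠ 0),
    1 / gap (multivariateGaussian 0 (baseCov K ρ)) i

/-! ### Strategies and their interaction with a bandit -/

/-- The pairs `(i, j)` with `i < j` that may be pulled. -/
abbrev Pair (K : ℕ) : Type := {p : Fin K × Fin K // p.1 < p.2}

/-- What is recorded in one round: the pulled pair and the two observed values. -/
abbrev Round (K : ℕ) : Type := Pair K × (ℝ × ℝ)

/-- An adaptive, possibly randomised, bandit strategy with budget `n`: the (conditional law of the)
next pair given the history so far, and the (conditional law of the) arm which is returned given
the history of all `n` rounds. -/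
structure Strategy (K n : ℕ) where
  sample : ∀ t : ℕ, Kernel (Fin t → Round K) (Pair K)
  isMarkov_sample : ∀ t, IsMarkovKernel (sample t)
  recommend : Kernel (Fin n → Round K) (Fin K)
  isMarkov_recommend : IsMarkovKernel recommend

/-- The law of the observation when a pair is pulled: the bivariate marginal of `ν`. -/
def observe {K : ℕ} (ν : Measure (EuclideanSpace ℝ (Fin K))) : Kernel (Pair K) (ℝ × ℝ) :=
  Kernel.ofFunOfCountable fun p => ν.map fun x => (x p.1.1, x p.1.2)

/-- The law of the history of the first `t` rounds when the arms have law `ν`, independently over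
time: given the past, a pair is drawn from the strategy, and given this pair (and independently of
the past) an observation is drawn from the bivariate law of the two arms. -/
def historyLaw {K n : ℕ} (A : Strategy K n) (ν : Measure (EuclideanSpace ℝ (Fin K))) :
    (t : ℕ) → Measure (Fin t → Round K)
  | 0 => Measure.dirac Fin.elim0
  | t + 1 =>
      ((historyLaw A ν t) ⊗ₘ (A.sample t ⊗ₖ Kernel.prodMkLeft (Fin t → Round K) (observe ν))).map
        fun x => Fin.snoc (α := fun _ => Round K) x.1 x.2

/-- The law of the arm `Â_n` returned after `n` rounds. -/
def outputLaw {K n : ℕ} (A : Strategy K n) (ν : Measure (EuclideanSpace ℝ (Fin K))) :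
    Measure (Fin K) :=
  (historyLaw A ν n).bind A.recommend

/-- `P_m (Â_n ≠ m)`. -/
def errorProb {K n : ℕ} [NeZero K] (A : Strategy K n) (ρ : ℝ) (m : Fin K) : ℝ :=
  (outputLaw A (problemLaw K ρ m)).real {a | a ≠ m}

/-! ### The constants -/

/-- The upper bound `1 - 1 / √(K - 2)` on `ρ²`. -/
def UB (K : ℕ) : ℝ := 1 - 1 / √((K : ℝ) - 2)

/-- `c₁ = 1 / (1 - UB)`. -/
def c₁ (K : ℕ) : ℝ := 1 / (1 - UB K)

/-- `c₂ = ρ / (1 - UB)`. -/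
def c₂ (K : ℕ) (ρ : ℝ) : ℝ := ρ / (1 - UB K)

/-- `c̃ = max (3 c₁, 48 c₂)`. -/
def cTilde (K : ℕ) (ρ : ℝ) : ℝ := max (3 * c₁ K) (48 * c₂ K ρ)

/-- The deviation `ε̃_n`; the parameter `u` is an upper bound on the variances of the arms. -/
def epsTilde (K : ℕ) (ρ u : ℝ) (n : ℕ) : ℝ :=
  cTilde K ρ * u *
    max (8 / n * Real.log (12 * K * (K - 1) * n)) (√(8 / n * Real.log (12 * K * (K - 1) * n)))

end CorrelatedBandit

end

/-! Two-point method with a Hellinger affinity. In every problem each pulled pair has unit variances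
and a covariance of square at most `ρ ^ 2`, so the laws of one observation under two problems have
affinity at least `√(1 - ρ ^ 2)`, whatever the pair. Since the strategy's kernels are common to both
problems, affinities multiply over the rounds. The errors of two problems then add up to at least
`(1 - ρ ^ 2) ^ n / 2` (`pow_div_two_le_errorProb_add`), so the larger is at least `exp (-n ρ² / (1 -
ρ²)) / 4`.

`AffinityBound c P Q M` takes `M` in the role of the normalised geometric mean of `P` and `Q`. Being
stated through test functions, it needs no densities and passes through maps and kernel
compositions.

For the complexity, Gaussian regression gives explicit mean-squared errors, hence `Δ_i ≥ (K - 2) ρ²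
(1 - ρ²)` for `i ≠ 1` (`le_gap`). With the bound `UB` on `ρ ^ 2` this yields `ρ² / (1 - ρ²) ≤ K /
H_lb`. The factor 6 and the deviation term are pure slack: only `ε̃_n ≥ 0` is needed. -/

namespace CorrelatedBandit

open scoped ENNReal NNReal

/-! ### A Hellinger-type relation between measures -/

section AffinityBound

variable {α β : Type*} [MeasurableSpace α] [MeasurableSpace β]

/-- The measures `P` and `Q` overlap, as measured by `M`, with an affinity of at least `c`. -/
def AffinityBound (c : ℝ≥0∞) (P Q M : Measure α) : Prop :=
  ∀ f g h : α → ℝ≥0∞, Measurable f → Measurable g → Measurable h → (∀ x, h x ^ 2 ≤ f x * g x) →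
    (c * ∫⁻ x, h x ∂M) ^ 2 ≤ (∫⁻ x, f x ∂P) * ∫⁻ x, g x ∂Q

lemma sq_lintegral_le {μ : Measure α} {f g h : α → ℝ≥0∞} (hf : Measurable f) (hg : Measurable g)
    (hfg : ∀ x, h x ^ 2 ≤ f x * g x) :
    (∫⁻ x, h x ∂μ) ^ 2 ≤ (∫⁻ x, f x ∂μ) * ∫⁻ x, g x ∂μ := by
  have sq_half (a : ℝ≥0∞) : (a ^ (1 / 2 : ℝ)) ^ 2 = a := by
    rw [← ENNReal.rpow_natCast, ← ENNReal.rpow_mul]; norm_num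
  have h1 : ∀ x, h x ≤ f x ^ (1 / 2 : ℝ) * g x ^ (1 / 2 : ℝ) := by
    intro x
    rw [← ENNReal.pow_le_pow_left_iff two_ne_zero, mul_pow, sq_half, sq_half]
    exact hfg x
  calc (∫⁻ x, h x ∂μ) ^ 2
      ≤ ((∫⁻ x, f x ∂μ) ^ (1 / 2 : ℝ) * (∫⁻ x, g x ∂μ) ^ (1 / 2 : ℝ)) ^ 2 := by
        gcongr
        exact (lintegral_mono h1).trans (ENNReal.lintegral_mul_norm_pow_le hf.aemeasurable
          hg.aemeasurable (by norm_num) (by norm_num) (by norm_num))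
    _ = _ := by rw [mul_pow, sq_half, sq_half]

namespace AffinityBound

lemma refl (P : Measure α) : AffinityBound 1 P P P := by
  intro f g h hf hg _ hfg
  rw [one_mul]
  exact sq_lintegral_le hf hg hfg

lemma mono {c d : ℝ≥0∞} {P Q M : Measure α} (hd : AffinityBound d P Q M) (hcd : c ≤ d) :
    AffinityBound c P Q M := by
  intro f g h hf hg hh hfg
  exact le_trans (by gcongr) (hd f g h hf hg hh hfg)

lemma withDensity {c : ℝ≥0∞} {μ : Measure α} {p q m : α → ℝ≥0∞} (hp : Measurable p)
    (hq : Measurable q) (hm : Measurable m) (hpq : ∀ x, (c * m x) ^ 2 ≤ p x * q x) :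
    AffinityBound c (μ.withDensity p) (μ.withDensity q) (μ.withDensity m) := by
  intro f g h hf hg hh hfg
  rw [lintegral_withDensity_eq_lintegral_mul _ hp hf, lintegral_withDensity_eq_lintegral_mul _ hq hg,
    lintegral_withDensity_eq_lintegral_mul _ hm hh, ← lintegral_const_mul _ (hm.mul hh)]
  refine sq_lintegral_le (hp.mul hf) (hq.mul hg) fun x => ?_
  calc (c * (m * h) x) ^ 2 = (c * m x) ^ 2 * h x ^ 2 := by simp only [Pi.mul_apply]; ring
    _ ≤ (p x * q x) * (f x * g x) := mul_le_mul' (hpq x) (hfg x)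
    _ = _ := by simp only [Pi.mul_apply]; ring

lemma map {c : ℝ≥0∞} {P Q M : Measure α} (H : AffinityBound c P Q M) {φ : α → β}
    (hφ : Measurable φ) : AffinityBound c (P.map φ) (Q.map φ) (M.map φ) := by
  intro f g h hf hg hh hfg
  rw [lintegral_map hf hφ, lintegral_map hg hφ, lintegral_map hh hφ]
  exact H _ _ _ (hf.comp hφ) (hg.comp hφ) (hh.comp hφ) fun x => hfg _

/-- Tensorisation: the bound on the kernels says precisely that the inner integrals are again
admissible test functions for the outer bound. -/
lemma compProd {c d : ℝ≥0∞} {P Q M : Measure α} [SFinite P] [SFinite Q] [SFinite M]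
    {κ η μ : Kernel α β} [IsSFiniteKernel κ] [IsSFiniteKernel η] [IsSFiniteKernel μ]
    (H : AffinityBound c P Q M) (H' : ∀ a, AffinityBound d (κ a) (η a) (μ a)) :
    AffinityBound (c * d) (P ⊗ₘ κ) (Q ⊗ₘ η) (M ⊗ₘ μ) := by
  intro f g h hf hg hh hfg
  rw [Measure.lintegral_compProd hf, Measure.lintegral_compProd hg, Measure.lintegral_compProd hh,
    mul_assoc, ← lintegral_const_mul _ hh.lintegral_kernel_prod_right']
  refine H _ _ _ hf.lintegral_kernel_prod_right' hg.lintegral_kernel_prod_right'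
    (hh.lintegral_kernel_prod_right'.const_mul d) fun a => ?_
  exact H' a _ _ _ (hf.comp measurable_prodMk_left) (hg.comp measurable_prodMk_left)
    (hh.comp measurable_prodMk_left) fun b => hfg _

/-- Data processing: a common kernel costs nothing, by Cauchy-Schwarz under `κ a`. -/
lemma bind {c : ℝ≥0∞} {P Q M : Measure α} (κ : Kernel α β) (H : AffinityBound c P Q M) :
    AffinityBound c (P.bind κ) (Q.bind κ) (M.bind κ) := by
  intro f g h hf hg hh hfg
  rw [Measure.lintegral_bind κ.measurable.aemeasurable hf.aemeasurable,
    Measure.lintegral_bind κ.measurable.aemeasurable hg.aemeasurable,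
    Measure.lintegral_bind κ.measurable.aemeasurable hh.aemeasurable]
  exact H _ _ _ hf.lintegral_kernel hg.lintegral_kernel hh.lintegral_kernel fun a =>
    sq_lintegral_le hf hg hfg

lemma prod {c d : ℝ≥0∞} {P Q M : Measure α} {P' Q' M' : Measure β} [SFinite P] [SFinite Q]
    [SFinite M] [SFinite P'] [SFinite Q'] [SFinite M']
    (H : AffinityBound c P Q M) (H' : AffinityBound d P' Q' M') :
    AffinityBound (c * d) (P.prod P') (Q.prod Q') (M.prod M') := by
  have := H.compProd (κ := Kernel.const α P') (η := Kernel.const α Q') (μ := Kernel.const α M')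
    (d := d) (fun a => by simpa using H')
  simpa using this

lemma sq_measure_le {c : ℝ≥0∞} {P Q M : Measure α} (H : AffinityBound c P Q M) {s : Set α}
    (hs : MeasurableSet s) : (c * M s) ^ 2 ≤ P s * Q s := by
  have := H (s.indicator 1) (s.indicator 1) (s.indicator 1) (measurable_one.indicator hs)
    (measurable_one.indicator hs) (measurable_one.indicator hs)
    (fun x => by by_cases hx : x ∈ s <;> simp [hx])
  simpa [lintegral_indicator_one hs] using this

/-- A lower bound, of Bretagnolle-Huber type, on the sum of the two errors of a test. -/
lemma sq_div_two_le {c : ℝ} (hc : 0 ≤ c) {P Q M : Measure α} [IsProbabilityMeasure P]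
    [IsProbabilityMeasure Q] [IsProbabilityMeasure M]
    (H : AffinityBound (ENNReal.ofReal c) P Q M) {s : Set α} (hs : MeasurableSet s) :
    c ^ 2 / 2 ≤ P.real sᶜ + Q.real s := by
  have key {t : Set α} (ht : MeasurableSet t) : (c * M.real t) ^ 2 ≤ P.real t * Q.real t := by
    have := ENNReal.toReal_mono (by finiteness) (H.sq_measure_le ht)
    simpa [Measure.real, ENNReal.toReal_ofReal hc] using this
  have h1 := key hs
  have h2 := key hs.compl
  have h3 := probReal_compl_eq_one_sub (μ := M) hs
  have hP : P.real s ≤ 1 := measureReal_le_one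
  have hQ : Q.real sᶜ ≤ 1 := measureReal_le_one
  have h4 : P.real s * Q.real s ≤ Q.real s := mul_le_of_le_one_left measureReal_nonneg hP
  have h5 : P.real sᶜ * Q.real sᶜ ≤ P.real sᶜ := mul_le_of_le_one_right measureReal_nonneg hQ
  rw [h3] at h2
  -- `M(s)² + M(sᶜ)² ≥ 1/2`, since the two masses add up to 1.
  nlinarith [mul_nonneg (sq_nonneg c) (sq_nonneg (2 * M.real s - 1))]

end AffinityBound

end AffinityBound

/-! ### Affinity of Gaussian laws -/

/-- The geometric mean of the two densities is a multiple of the Gaussian density whose precision is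
the average of the two precisions; the multiple is the Bhattacharyya coefficient, so the density
condition holds with equality. -/
lemma affinityBound_gaussianReal {v w : ℝ≥0} (hv : v ≠ 0) (hw : w ≠ 0) :
    AffinityBound (ENNReal.ofReal √(2 * √(v * w) / (v + w))) (gaussianReal 0 v) (gaussianReal 0 w)
      (gaussianReal 0 (2 * v * w / (v + w))) := by
  have hv' : (0 : ℝ) < v := by positivity
  have hw' : (0 : ℝ) < w := by positivity
  have hm : 2 * v * w / (v + w) ≠ 0 := by positivity
  rw [gaussianReal_of_var_ne_zero _ hv, gaussianReal_of_var_ne_zero _ hw,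
    gaussianReal_of_var_ne_zero _ hm]
  refine AffinityBound.withDensity (measurable_gaussianPDF _ _) (measurable_gaussianPDF _ _)
    (measurable_gaussianPDF _ _) fun x => ?_
  simp only [gaussianPDF]
  rw [← ENNReal.ofReal_mul (by positivity), ← ENNReal.ofReal_pow
    (mul_nonneg (by positivity) (gaussianPDFReal_nonneg _ _ _)),
    ← ENNReal.ofReal_mul (gaussianPDFReal_nonneg _ _ _)]
  refine ENNReal.ofReal_le_ofReal (le_of_eq ?_)
  simp only [gaussianPDFReal, sub_zero, mul_pow, inv_pow]
  rw [Real.sq_sqrt (by positivity), Real.sq_sqrt (by positivity), ← Real.exp_nat_mul]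
  have hexp : Real.exp (((2 : ℕ) : ℝ) * (-x ^ 2 / (2 * ((2 * v * w / (v + w) : ℝ≥0) : ℝ)))) =
      Real.exp (-x ^ 2 / (2 * v)) * Real.exp (-x ^ 2 / (2 * w)) := by
    rw [← Real.exp_add]
    congr 1
    push_cast
    field_simp
    ring
  rw [hexp]
  have hs : √(2 * Real.pi * v) * √(2 * Real.pi * w) = 2 * Real.pi * √(v * w) := by
    rw [← Real.sqrt_mul (by positivity), show 2 * Real.pi * v * (2 * Real.pi * w) =
      (2 * Real.pi) ^ 2 * (v * w) by ring, Real.sqrt_mul (by positivity),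
      Real.sqrt_sq (by positivity)]
  have hq : √((v : ℝ) * w) ^ 2 = v * w := Real.sq_sqrt (by positivity)
  have hq0 : 0 < √((v : ℝ) * w) := by positivity
  have hcoef : 2 * √((v : ℝ) * w) / (v + w) * (2 * Real.pi * ((2 * v * w / (v + w) : ℝ≥0) : ℝ))⁻¹ =
      (√(2 * Real.pi * v))⁻¹ * (√(2 * Real.pi * w))⁻¹ := by
    rw [← mul_inv, hs]
    push_cast
    field_simp
    linear_combination hq
  linear_combination (Real.exp (-x ^ 2 / (2 * v)) * Real.exp (-x ^ 2 / (2 * w))) * hcoef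

/-- The centred Gaussian law on the plane with unit variances and covariance `s`. -/
noncomputable def bivariateGaussian (s : ℝ) : Measure (ℝ × ℝ) :=
  ((gaussianReal 0 (2 + 2 * s).toNNReal).prod (gaussianReal 0 (2 - 2 * s).toNNReal)).map
    fun z => ((z.1 + z.2) / 2, (z.1 - z.2) / 2)

/-- The sum and difference coordinates are independent for every covariance, so the affinity
factorises. Its square is `√((1 - a²)(1 - b²)) / (1 - (a + b)² / 4)`, which is at least `1 - r`. -/
lemma exists_affinityBound_bivariateGaussian {a b r : ℝ} (ha : a ^ 2 ≤ r) (hb : b ^ 2 ≤ r)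
    (hr : r < 1) :
    ∃ M : Measure (ℝ × ℝ), IsProbabilityMeasure M ∧
      AffinityBound (ENNReal.ofReal √(1 - r)) (bivariateGaussian a) (bivariateGaussian b) M := by
  obtain ⟨ha1, ha2⟩ := abs_lt.1 ((sq_lt_one_iff_abs_lt_one a).1 (ha.trans_lt hr))
  obtain ⟨hb1, hb2⟩ := abs_lt.1 ((sq_lt_one_iff_abs_lt_one b).1 (hb.trans_lt hr))
  have hφ : Measurable fun z : ℝ × ℝ => ((z.1 + z.2) / 2, (z.1 - z.2) / 2) := by fun_prop
  have key := ((affinityBound_gaussianReal (v := (2 + 2 * a).toNNReal) (w := (2 + 2 * b).toNNReal)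
    (by simpa using by linarith) (by simpa using by linarith)).prod
    (affinityBound_gaussianReal (v := (2 - 2 * a).toNNReal) (w := (2 - 2 * b).toNNReal)
    (by simpa using by linarith) (by simpa using by linarith))).map hφ
  refine ⟨_, Measure.isProbabilityMeasure_map hφ.aemeasurable, key.mono ?_⟩
  rw [← ENNReal.ofReal_mul (by positivity), Real.coe_toNNReal _ (by linarith),
    Real.coe_toNNReal _ (by linarith), Real.coe_toNNReal _ (by linarith),
    Real.coe_toNNReal _ (by linarith), ← Real.sqrt_mul (by
      refine div_nonneg (by positivity) (by linarith))]
  refine ENNReal.ofReal_le_ofReal (Real.sqrt_le_sqrt ?_)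
  have h1 : 4 * (1 - r) ≤ √((2 + 2 * a) * (2 + 2 * b)) * √((2 - 2 * a) * (2 - 2 * b)) := by
    rw [← Real.sqrt_mul (mul_nonneg (by linarith) (by linarith))]
    refine Real.le_sqrt_of_sq_le ?_
    nlinarith [mul_le_mul (sub_le_sub_left ha 1) (sub_le_sub_left hb 1) (by linarith)
      (by linarith)]
  have hpos : 0 < (2 + 2 * a + (2 + 2 * b)) * (2 - 2 * a + (2 - 2 * b)) :=
    mul_pos (by linarith) (by linarith)
  rw [div_mul_div_comm, le_div_iff₀ hpos]
  nlinarith [mul_nonneg (sub_nonneg.2 hr.le) (sq_nonneg (a + b))]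

/-! ### Coordinate pairs of a Gaussian vector -/

section Gaussian

variable {ι : Type*} [Fintype ι] [DecidableEq ι] {S : Matrix ι ι ℝ}

lemma memLp_eval_multivariateGaussian (i : ι) :
    MemLp (fun x : EuclideanSpace ℝ ι => x i) 2 (multivariateGaussian 0 S) :=
  (EuclideanSpace.proj (𝕜 := ℝ) i).comp_memLp' IsGaussian.memLp_two_id

lemma symm_apply_of_posSemidef {ι : Type*} {S : Matrix ι ι ℝ} (hS : S.PosSemidef) (i j : ι) :
    S i j = S j i := by
  simpa using (hS.isHermitian.apply i j).symm

/-- Two linear combinations of the coordinates of a centred Gaussian vector are independent,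
centred and Gaussian if they are uncorrelated. -/
lemma map_prodMk_eq_prod_gaussianReal (L L' : EuclideanSpace ℝ ι →L[ℝ] ℝ)
    (h : cov[L, L'; multivariateGaussian 0 S] = 0) :
    (multivariateGaussian 0 S).map (fun x => (L x, L' x)) =
      (gaussianReal 0 Var[L; multivariateGaussian 0 S].toNNReal).prod
        (gaussianReal 0 Var[L'; multivariateGaussian 0 S].toNNReal) := by
  have hmap (T : EuclideanSpace ℝ ι →L[ℝ] ℝ) : (multivariateGaussian 0 S).map T =
      gaussianReal 0 Var[T; multivariateGaussian 0 S].toNNReal := by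
    rw [IsGaussian.map_eq_gaussianReal, T.integral_comp_id_comm IsGaussian.integrable_id]
    simp
  have hg : HasGaussianLaw (fun x => (L x, L' x)) (multivariateGaussian 0 S) :=
    (IsGaussian.hasGaussianLaw_id (μ := multivariateGaussian 0 S)).map_fun (L.prod L')
  have hind := hg.indepFun_of_covariance_eq_zero h
  rw [(indepFun_iff_map_prod_eq_prod_map_map (by fun_prop) (by fun_prop)).1 hind]
  rw [← hmap, ← hmap]

lemma map_pair_multivariateGaussian (hS : S.PosSemidef) {i j : ι} (hi : S i i = 1)
    (hj : S j j = 1) :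
    (multivariateGaussian 0 S).map (fun x => (x i, x j)) = bivariateGaussian (S i j) := by
  set ν := multivariateGaussian (0 : EuclideanSpace ℝ ι) S with hν
  let p (k : ι) : EuclideanSpace ℝ ι →L[ℝ] ℝ := EuclideanSpace.proj k
  have hmem (k : ι) : MemLp (p k) 2 ν := memLp_eval_multivariateGaussian k
  have hcov (k l : ι) : cov[p k, p l; ν] = S k l := covariance_eval_multivariateGaussian hS k l
  have hvar (k : ι) : Var[p k; ν] = S k k := variance_eval_multivariateGaussian hS k
  have h0 : cov[p i + p j, p i - p j; ν] = 0 := by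
    rw [FunLike.coe_add, covariance_add_left (hmem i) (hmem j) ((hmem i).sub (hmem j)),
      covariance_sub_right (hmem i) (hmem i) (hmem j),
      covariance_sub_right (hmem j) (hmem i) (hmem j), hcov, hcov, hcov, hcov,
      symm_apply_of_posSemidef hS j i, hi, hj]
    ring
  have hp : Var[p i + p j; ν] = 2 + 2 * S i j := by
    rw [FunLike.coe_add, variance_add (hmem i) (hmem j), hvar, hvar, hcov, hi, hj]; ring
  have hm : Var[p i - p j; ν] = 2 - 2 * S i j := by
    rw [FunLike.coe_sub, variance_sub (hmem i) (hmem j), hvar, hvar, hcov, hi, hj]; ring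
  have key := map_prodMk_eq_prod_gaussianReal (S := S) (p i + p j) (p i - p j) h0
  rw [← hν] at key
  rw [hp, hm] at key
  rw [bivariateGaussian, ← key, Measure.map_map (by fun_prop) (by fun_prop)]
  congr 1
  ext x <;> simp [p]

end Gaussian

/-! ### The minimum mean-squared errors of a Gaussian vector -/

lemma le_lintegral_sq_add_gaussianReal (v : ℝ≥0) (c : ℝ) :
    (v : ℝ≥0∞) ≤ ∫⁻ y, ENNReal.ofReal ((y + c) ^ 2) ∂(gaussianReal 0 v) := by
  have hmem : MemLp (fun y : ℝ => y + c) 2 (gaussianReal 0 v) :=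
    (memLp_id_gaussianReal 2).add (memLp_const c)
  rw [← ofReal_integral_eq_lintegral_ofReal hmem.integrable_sq
    (Filter.Eventually.of_forall fun y => sq_nonneg _)]
  have h1 := variance_le_expectation_sq (X := fun y : ℝ => y + c) (μ := gaussianReal 0 v)
    (by fun_prop)
  rw [variance_add_const (by fun_prop), variance_fun_id_gaussianReal] at h1
  rw [← ENNReal.ofReal_coe_nnreal]
  exact ENNReal.ofReal_le_ofReal h1

lemma lintegral_sq_gaussianReal (v : ℝ≥0) :
    ∫⁻ y, ENNReal.ofReal (y ^ 2) ∂(gaussianReal 0 v) = v := by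
  have hmem : MemLp (fun y : ℝ => y) 2 (gaussianReal 0 v) := memLp_id_gaussianReal 2
  rw [← ofReal_integral_eq_lintegral_ofReal hmem.integrable_sq
    (Filter.Eventually.of_forall fun y => sq_nonneg _)]
  have h := variance_of_integral_eq_zero (X := fun y : ℝ => y) (μ := gaussianReal 0 v)
    (by fun_prop) integral_id_gaussianReal
  rw [variance_fun_id_gaussianReal] at h
  rw [← h, ENNReal.ofReal_coe_nnreal]

section Residual

variable {K : ℕ} {S : Matrix (Fin K) (Fin K) ℝ}

/-- The regression residual is uncorrelated with `x i`, hence independent of it. -/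
lemma map_eval_residual (hS : S.PosSemidef) {i : Fin K} (hi : S i i = 1) (j : Fin K) :
    (multivariateGaussian 0 S).map (fun x => (x i, x j - S i j * x i)) =
      (gaussianReal 0 1).prod (gaussianReal 0 (S j j - S i j ^ 2).toNNReal) := by
  set ν := multivariateGaussian (0 : EuclideanSpace ℝ (Fin K)) S with hν
  let p (k : Fin K) : EuclideanSpace ℝ (Fin K) →L[ℝ] ℝ := EuclideanSpace.proj k
  have hmem (k : Fin K) : MemLp (p k) 2 ν := memLp_eval_multivariateGaussian k
  have hcov (k l : Fin K) : cov[p k, p l; ν] = S k l := covariance_eval_multivariateGaussian hS k l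
  have hvar (k : Fin K) : Var[p k; ν] = S k k := variance_eval_multivariateGaussian hS k
  have h0 : cov[p i, p j - S i j • p i; ν] = 0 := by
    rw [covariance_sub_right (hmem i) (hmem j)
      ((hmem i).const_smul _), covariance_smul_right, hcov, hcov, hi]
    ring
  have hv : Var[p j - S i j • p i; ν] = S j j - S i j ^ 2 := by
    rw [FunLike.coe_sub, FunLike.coe_smul, variance_sub (hmem j) ((hmem i).const_smul _),
      variance_smul, covariance_smul_right, hcov, hvar, hvar, hi, symm_apply_of_posSemidef hS j i]
    ring
  have key := map_prodMk_eq_prod_gaussianReal (S := S) (p i) (p j - S i j • p i) h0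
  rw [← hν, hv, hvar, hi, Real.toNNReal_one] at key
  exact key

lemma le_lintegral_sq_sub (hS : S.PosSemidef) {i : Fin K} (hi : S i i = 1) (j : Fin K)
    {h : ℝ → ℝ} (hh : Measurable h) :
    ENNReal.ofReal (S j j - S i j ^ 2) ≤
      ∫⁻ x, ENNReal.ofReal ((x j - h (x i)) ^ 2) ∂(multivariateGaussian 0 S) := by
  have hm : Measurable fun z : ℝ × ℝ =>
      ENNReal.ofReal ((z.2 + (S i j * z.1 - h z.1)) ^ 2) := by fun_prop
  calc ENNReal.ofReal (S j j - S i j ^ 2)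
      ≤ ∫⁻ x, ∫⁻ y, ENNReal.ofReal ((y + (S i j * x - h x)) ^ 2)
          ∂(gaussianReal 0 (S j j - S i j ^ 2).toNNReal) ∂(gaussianReal 0 1) := by
        refine le_trans ?_ (lintegral_mono fun x => le_lintegral_sq_add_gaussianReal _ _)
        simp [ENNReal.ofReal]
    _ = _ := by
        rw [← lintegral_prod _ hm.aemeasurable, ← map_eval_residual hS hi j,
          lintegral_map hm (by fun_prop)]
        refine lintegral_congr fun x => ?_
        congr 2
        ring

lemma lintegral_sq_residual (hS : S.PosSemidef) {i : Fin K} (hi : S i i = 1) (j : Fin K) :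
    ∫⁻ x, ENNReal.ofReal ((x j - S i j * x i) ^ 2) ∂(multivariateGaussian 0 S) =
      ENNReal.ofReal (S j j - S i j ^ 2) := by
  have hm : Measurable fun z : ℝ × ℝ => ENNReal.ofReal (z.2 ^ 2) := by fun_prop
  rw [← lintegral_map (f := fun z : ℝ × ℝ => ENNReal.ofReal (z.2 ^ 2))
    (g := fun x : EuclideanSpace ℝ (Fin K) => (x i, x j - S i j * x i)) hm (by fun_prop),
    map_eval_residual hS hi j, lintegral_prod _ hm.aemeasurable]
  simp only [lintegral_sq_gaussianReal, lintegral_const, measure_univ, mul_one]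
  rfl

lemma lintegral_norm_sub_sq (ν : Measure (EuclideanSpace ℝ (Fin K)))
    {g : ℝ → EuclideanSpace ℝ (Fin K)} (hg : Measurable g) (i : Fin K) :
    ∫⁻ x, ENNReal.ofReal (‖x - g (x i)‖ ^ 2) ∂ν =
      ∑ j, ∫⁻ x, ENNReal.ofReal ((x j - g (x i) j) ^ 2) ∂ν := by
  rw [← lintegral_finsetSum _ fun j _ => by fun_prop]
  refine lintegral_congr fun x => ?_
  rw [EuclideanSpace.real_norm_sq_eq, ENNReal.ofReal_sum_of_nonneg fun j _ => sq_nonneg _]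
  rfl

/-- The error splits over coordinates. Given `x i`, any predictor only shifts the centred residual,
which cannot lower its second moment; linear regression attains the bound in all coordinates at
once. -/
lemma mmse_multivariateGaussian (hS : S.PosSemidef) {i : Fin K} (hi : S i i = 1)
    (hle : ∀ j, S i j ^ 2 ≤ S j j) :
    mmse (multivariateGaussian 0 S) i = ∑ j, (S j j - S i j ^ 2) := by
  have hnn : ∀ j ∈ Finset.univ, 0 ≤ S j j - S i j ^ 2 := fun j _ => sub_nonneg.2 (hle j)
  have key : (⨅ (g : ℝ → EuclideanSpace ℝ (Fin K)) (_ : Measurable g),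
      ∫⁻ x, ENNReal.ofReal (‖x - g (x i)‖ ^ 2) ∂(multivariateGaussian 0 S)) =
      ENNReal.ofReal (∑ j, (S j j - S i j ^ 2)) := by
    rw [ENNReal.ofReal_sum_of_nonneg hnn]
    refine le_antisymm ?_ (le_iInf₂ fun g hg => ?_)
    · have hg : Measurable fun t : ℝ => (WithLp.toLp 2 fun j => S i j * t :
          EuclideanSpace ℝ (Fin K)) := by fun_prop
      refine iInf₂_le_of_le _ hg ?_
      rw [lintegral_norm_sub_sq _ hg]
      exact le_of_eq (Finset.sum_congr rfl fun j _ => lintegral_sq_residual hS hi j)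
    · rw [lintegral_norm_sub_sq _ hg]
      exact Finset.sum_le_sum fun j _ =>
        le_lintegral_sq_sub hS hi j (h := fun t => g t j) (by fun_prop)
  rw [mmse, key, ENNReal.toReal_ofReal (Finset.sum_nonneg hnn)]

end Residual

/-! ### The gaps and the complexity -/

lemma baseCov_self (K : ℕ) (ρ : ℝ) (i : Fin K) : baseCov K ρ i i = 1 := by simp [baseCov]

lemma baseCov_sq_of_ne {K : ℕ} (ρ : ℝ) {i j : Fin K} (h : i ≠ j) :
    baseCov K ρ i j ^ 2 = (ρ ^ 2) ^ (min (i : ℕ) (j : ℕ) + 1) := by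
  simp only [baseCov, Matrix.of_apply, if_neg h]
  ring

lemma baseCov_sq_le_of_ne {K : ℕ} {ρ : ℝ} (hρ : ρ ^ 2 ≤ 1) {i j : Fin K} (h : i ≠ j) :
    baseCov K ρ i j ^ 2 ≤ ρ ^ 2 := by
  rw [baseCov_sq_of_ne ρ h]
  exact pow_le_of_le_one (sq_nonneg ρ) hρ (by omega)

lemma baseCov_sq_le {K : ℕ} {ρ : ℝ} (hρ : ρ ^ 2 ≤ 1) (i j : Fin K) :
    baseCov K ρ i j ^ 2 ≤ baseCov K ρ j j := by
  rw [baseCov_self]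
  rcases eq_or_ne i j with rfl | h
  · simp [baseCov_self]
  · exact (baseCov_sq_le_of_ne hρ h).trans hρ

/-- A generic coordinate contributes at least `ρ² - ρ⁴`. The indicator terms correct the coordinates
`0` and `i`, whose true contributions `±(1 - ρ²)` cancel on summation; this leaves the factor `K -
2`. -/
lemma baseCov_zero_sq_sub_ge {K : ℕ} [NeZero K] {ρ : ℝ} (hρ : ρ ^ 2 ≤ 1) {i : Fin K} (hi : i ≠ 0)
    (j : Fin K) :
    ρ ^ 2 * (1 - ρ ^ 2) + ((if j = 0 then (1 - ρ ^ 2) - ρ ^ 2 * (1 - ρ ^ 2) else 0) +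
      if j = i then -(1 - ρ ^ 2) - ρ ^ 2 * (1 - ρ ^ 2) else 0) ≤
      baseCov K ρ 0 j ^ 2 - baseCov K ρ i j ^ 2 := by
  by_cases hj0 : j = 0
  · subst hj0
    rw [if_pos rfl, if_neg hi.symm, baseCov_self, baseCov_sq_of_ne ρ hi]
    simp
  · by_cases hji : j = i
    · subst hji
      rw [if_neg hj0, if_pos rfl, baseCov_self, baseCov_sq_of_ne ρ (Ne.symm hj0)]
      simp
    · rw [if_neg hj0, if_neg hji, baseCov_sq_of_ne ρ (Ne.symm hj0),
        baseCov_sq_of_ne ρ (Ne.symm hji)]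
      have h1 : 1 ≤ (i : ℕ) := Nat.one_le_iff_ne_zero.2 fun h => hi (Fin.ext h)
      have h2 : 1 ≤ (j : ℕ) := Nat.one_le_iff_ne_zero.2 fun h => hj0 (Fin.ext h)
      have h3 : (ρ ^ 2) ^ (min (i : ℕ) (j : ℕ) + 1) ≤ (ρ ^ 2) ^ 2 :=
        pow_le_pow_of_le_one (sq_nonneg ρ) hρ (by omega)
      have h4 : min ((0 : Fin K) : ℕ) (j : ℕ) = 0 := by simp
      rw [h4]
      linear_combination h3

lemma le_gap {K : ℕ} [NeZero K] {ρ : ℝ} (hρ : ρ ^ 2 ≤ 1) (hcov : (baseCov K ρ).PosSemidef)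
    {i : Fin K} (hi : i ≠ 0) :
    (K - 2) * (ρ ^ 2 * (1 - ρ ^ 2)) ≤ gap (multivariateGaussian 0 (baseCov K ρ)) i := by
  have h0 : ⨅ j, mmse (multivariateGaussian 0 (baseCov K ρ)) j ≤
      mmse (multivariateGaussian 0 (baseCov K ρ)) 0 :=
    ciInf_le (Set.finite_range _).bddBelow 0
  rw [gap]
  refine le_trans ?_ (sub_le_sub_left h0 _)
  rw [mmse_multivariateGaussian hcov (baseCov_self K ρ i) (baseCov_sq_le hρ i),
    mmse_multivariateGaussian hcov (baseCov_self K ρ 0) (baseCov_sq_le hρ 0),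
    ← Finset.sum_sub_distrib]
  have := Finset.sum_le_sum fun j (_ : j ∈ Finset.univ) => baseCov_zero_sq_sub_ge hρ hi j
  simp only [Finset.sum_add_distrib, Finset.sum_ite_eq', Finset.mem_univ, if_true,
    Finset.sum_const, Finset.card_univ, Fintype.card_fin, nsmul_eq_mul] at this
  calc _ ≤ _ := by linarith
    _ ≤ _ := this
    _ = _ := Finset.sum_congr rfl fun j _ => by ring

lemma one_le_sq_one_sub {K : ℕ} (hK : 3 ≤ K) {r : ℝ} (hr : r ≤ UB K) :
    r < 1 ∧ 1 ≤ (1 - r) ^ 2 * (K - 2) := by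
  have hK' : (1 : ℝ) ≤ K - 2 := by
    have : (3 : ℝ) ≤ K := by exact_mod_cast hK
    linarith
  have hs : 0 < √((K : ℝ) - 2) := Real.sqrt_pos.2 (by linarith)
  have h1 : 1 / √((K : ℝ) - 2) ≤ 1 - r := by rw [UB] at hr; linarith
  have h2 : 0 < 1 / √((K : ℝ) - 2) := by positivity
  refine ⟨by linarith, ?_⟩
  have h3 : (1 / √((K : ℝ) - 2)) ^ 2 ≤ (1 - r) ^ 2 := pow_le_pow_left₀ h2.le h1 2
  rw [div_pow, Real.sq_sqrt (by linarith), div_le_iff₀ (by linarith)] at h3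
  linarith

lemma div_one_sub_le_div_Hlb {K : ℕ} [NeZero K] (hK : 3 ≤ K) {ρ : ℝ} (hρ : ρ ^ 2 ≤ UB K)
    (hcov : (baseCov K ρ).PosSemidef) : ρ ^ 2 / (1 - ρ ^ 2) ≤ K / Hlb K ρ := by
  obtain ⟨hr1, hr2⟩ := one_le_sq_one_sub hK hρ
  have hK' : (3 : ℝ) ≤ K := by exact_mod_cast hK
  have hpos1 : 0 < 1 - ρ ^ 2 := by linarith
  -- For `ρ = 0` the lower bound on the gaps degenerates to 0; nonnegativity of `Hlb` is enough
  -- there, even with division by zero.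
  rcases (sq_nonneg ρ).eq_or_lt with h0 | h0
  · rw [← h0, zero_div]
    refine div_nonneg (by linarith) (Finset.sum_nonneg fun i hi => ?_)
    have := le_gap hr1.le hcov (Finset.mem_filter.1 hi).2
    rw [← h0] at this
    exact one_div_nonneg.2 (by linarith)
  have hd : 0 < (K - 2) * (ρ ^ 2 * (1 - ρ ^ 2)) :=
    mul_pos (by linarith) (mul_pos h0 hpos1)
  have hcard : (Finset.univ.filter fun i : Fin K => i ≠ 0).card = K - 1 := by
    rw [Finset.filter_ne', Finset.card_erase_of_mem (Finset.mem_univ _), Finset.card_univ,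
      Fintype.card_fin]
  have hle : Hlb K ρ ≤ (K - 1) * (1 / ((K - 2) * (ρ ^ 2 * (1 - ρ ^ 2)))) := by
    have := Finset.sum_le_card_nsmul (Finset.univ.filter fun i : Fin K => i ≠ 0)
      (fun i => 1 / gap (multivariateGaussian 0 (baseCov K ρ)) i) _ fun i hi =>
      one_div_le_one_div_of_le hd (le_gap hr1.le hcov (Finset.mem_filter.1 hi).2)
    rw [hcard, nsmul_eq_mul, Nat.cast_sub (by omega), Nat.cast_one] at this
    exact this
  have hH : 0 < Hlb K ρ := by
    refine Finset.sum_pos (fun i hi => one_div_pos.2 (hd.trans_le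
      (le_gap hr1.le hcov (Finset.mem_filter.1 hi).2))) (Finset.card_pos.1 ?_)
    rw [hcard]
    omega
  rw [div_le_div_iff₀ hpos1 hH]
  calc ρ ^ 2 * Hlb K ρ
      ≤ ρ ^ 2 * ((K - 1) * (1 / ((K - 2) * (ρ ^ 2 * (1 - ρ ^ 2))))) := by gcongr
    _ = (K - 1) / ((K - 2) * (1 - ρ ^ 2)) := by
        have : (K : ℝ) - 2 ≠ 0 := by linarith
        have : ρ ≠ 0 := by rintro rfl; simp at h0
        field_simp
    _ ≤ (K - 1) * (1 - ρ ^ 2) := by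
        rw [div_le_iff₀ (mul_pos (by linarith) hpos1)]
        -- This is where `(1 - ρ²)² (K - 2) ≥ 1`, the content of the bound `UB`, is used.
        nlinarith
    _ ≤ K * (1 - ρ ^ 2) := by gcongr; linarith

lemma epsTilde_nonneg {K : ℕ} (ρ : ℝ) {u : ℝ} (hu : 0 ≤ u) (n : ℕ) : 0 ≤ epsTilde K ρ u n := by
  have h1 : 0 ≤ c₁ K := by
    rw [c₁, UB, sub_sub_cancel]
    positivity
  -- The sign of `ρ`, and so of `c₂`, is irrelevant because of the maximum with `3 c₁`.
  have h2 : 0 ≤ cTilde K ρ := le_max_of_le_left (by positivity)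
  exact mul_nonneg (mul_nonneg h2 hu) (le_max_of_le_right (Real.sqrt_nonneg _))

/-! ### The law of the history -/

section History

variable {K n : ℕ} (A : Strategy K n)

instance isMarkovKernel_sample (t : ℕ) : IsMarkovKernel (A.sample t) := A.isMarkov_sample t

instance isMarkovKernel_recommend : IsMarkovKernel A.recommend := A.isMarkov_recommend

instance isMarkovKernel_observe (ν : Measure (EuclideanSpace ℝ (Fin K))) [IsProbabilityMeasure ν] :
    IsMarkovKernel (observe ν) :=
  ⟨fun p => Measure.isProbabilityMeasure_map (by fun_prop)⟩

lemma measurable_snoc_history (t : ℕ) :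
    Measurable fun x : (Fin t → Round K) × Round K =>
      (Fin.snoc (α := fun _ => Round K) x.1 x.2 : Fin (t + 1) → Round K) := by
  refine measurable_pi_iff.2 fun i => ?_
  refine Fin.lastCases ?_ (fun i => ?_) i
  · simpa using measurable_snd
  · simp only [Fin.snoc_castSucc]
    fun_prop

instance isProbabilityMeasure_historyLaw (ν : Measure (EuclideanSpace ℝ (Fin K)))
    [IsProbabilityMeasure ν] (t : ℕ) : IsProbabilityMeasure (historyLaw A ν t) := by
  induction t with
  | zero => rw [historyLaw]; infer_instance
  | succ t ih =>
    rw [historyLaw]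
    exact Measure.isProbabilityMeasure_map (measurable_snoc_history t).aemeasurable

lemma exists_affinityBound_historyLaw {c : ℝ≥0∞} (ν ν' : Measure (EuclideanSpace ℝ (Fin K)))
    [IsProbabilityMeasure ν] [IsProbabilityMeasure ν']
    (H : ∀ p : Pair K, ∃ M : Measure (ℝ × ℝ), IsProbabilityMeasure M ∧
      AffinityBound c (observe ν p) (observe ν' p) M) (t : ℕ) :
    ∃ M : Measure (Fin t → Round K), IsProbabilityMeasure M ∧
      AffinityBound (c ^ t) (historyLaw A ν t) (historyLaw A ν' t) M := by
  choose N hN hNc using H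
  induction t with
  | zero => exact ⟨_, isProbabilityMeasure_historyLaw A ν 0, by
      rw [pow_zero]; exact AffinityBound.refl _⟩
  | succ t ih =>
    obtain ⟨M, hM, hMc⟩ := ih
    let κ : Kernel (Pair K) (ℝ × ℝ) := Kernel.ofFunOfCountable N
    have hκ : IsMarkovKernel κ := ⟨hN⟩
    have hstep (h : Fin t → Round K) :
        AffinityBound c ((A.sample t ⊗ₖ Kernel.prodMkLeft (Fin t → Round K) (observe ν)) h)
          ((A.sample t ⊗ₖ Kernel.prodMkLeft (Fin t → Round K) (observe ν')) h)
          ((A.sample t ⊗ₖ Kernel.prodMkLeft (Fin t → Round K) κ) h) := by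
      rw [Kernel.compProd_apply_eq_compProd_sectR, Kernel.compProd_apply_eq_compProd_sectR,
        Kernel.compProd_apply_eq_compProd_sectR]
      -- Both problems choose the pair by the same kernel, so this choice has affinity 1 and only
      -- the observation costs a factor `c`.
      simpa using (AffinityBound.refl (A.sample t h)).compProd (d := c)
        (κ := Kernel.sectR (Kernel.prodMkLeft (Fin t → Round K) (observe ν)) h)
        (η := Kernel.sectR (Kernel.prodMkLeft (Fin t → Round K) (observe ν')) h)
        (μ := Kernel.sectR (Kernel.prodMkLeft (Fin t → Round K) κ) h) fun p => hNc p
    have hmeas := measurable_snoc_history (K := K) t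
    refine ⟨(M ⊗ₘ (A.sample t ⊗ₖ Kernel.prodMkLeft (Fin t → Round K) κ)).map _,
      Measure.isProbabilityMeasure_map hmeas.aemeasurable, ?_⟩
    rw [pow_succ]
    exact (hMc.compProd hstep).map hmeas

instance isProbabilityMeasure_outputLaw (ν : Measure (EuclideanSpace ℝ (Fin K)))
    [IsProbabilityMeasure ν] : IsProbabilityMeasure (outputLaw A ν) := by
  rw [outputLaw]; infer_instance

end History

/-! ### Two-point comparison of problems -/

lemma exists_affinityBound_observe {K : ℕ} [NeZero K] {ρ : ℝ} (hρ : ρ ^ 2 < 1)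
    (hcov : (baseCov K ρ).PosSemidef) (m m' : Fin K) (p : Pair K) :
    ∃ M : Measure (ℝ × ℝ), IsProbabilityMeasure M ∧
      AffinityBound (ENNReal.ofReal √(1 - ρ ^ 2)) (observe (problemLaw K ρ m) p)
        (observe (problemLaw K ρ m') p) M := by
  have hpair (k : Fin K) : observe (problemLaw K ρ k) p =
      bivariateGaussian (swapCov K ρ k p.1.1 p.1.2) :=
    map_pair_multivariateGaussian (hcov.submatrix _) (baseCov_self K ρ _) (baseCov_self K ρ _)
  have hsq (k : Fin K) : swapCov K ρ k p.1.1 p.1.2 ^ 2 ≤ ρ ^ 2 :=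
    baseCov_sq_le_of_ne hρ.le ((Equiv.injective _).ne p.2.ne)
  rw [hpair, hpair]
  exact exists_affinityBound_bivariateGaussian (hsq m) (hsq m') hρ

lemma pow_div_two_le_errorProb_add {K n : ℕ} [NeZero K] {ρ : ℝ} (hρ : ρ ^ 2 < 1)
    (hcov : (baseCov K ρ).PosSemidef) (A : Strategy K n) {m m' : Fin K} (hm : m ≠ m') :
    (1 - ρ ^ 2) ^ n / 2 ≤ errorProb A ρ m + errorProb A ρ m' := by
  have hprob (k : Fin K) : IsProbabilityMeasure (problemLaw K ρ k) := by
    rw [problemLaw]; infer_instance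
  obtain ⟨M, hM, hMc⟩ := exists_affinityBound_historyLaw A (problemLaw K ρ m) (problemLaw K ρ m')
    (exists_affinityBound_observe hρ hcov m m') n
  have hout := hMc.bind A.recommend
  rw [← ENNReal.ofReal_pow (Real.sqrt_nonneg _)] at hout
  -- Test event: the answer is `m`. Its complement is the error in problem `m`, and it is itself an
  -- error in problem `m'`.
  have hsum := AffinityBound.sq_div_two_le (P := outputLaw A (problemLaw K ρ m))
    (Q := outputLaw A (problemLaw K ρ m')) (by positivity) hout (MeasurableSet.singleton m)
  rw [← pow_mul, mul_comm, pow_mul, Real.sq_sqrt (by linarith)] at hsum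
  refine hsum.trans (add_le_add le_rfl (measureReal_mono ?_))
  simpa using hm

/-- Inverted, this is `1 + x ≤ exp x` at `x = r / (1 - r)`, as `1 / (1 - r) = 1 + x`. -/
lemma exp_neg_div_le_one_sub {r : ℝ} (hr : r < 1) : Real.exp (-(r / (1 - r))) ≤ 1 - r := by
  have h : 0 < 1 - r := by linarith
  rw [Real.exp_neg, inv_le_comm₀ (Real.exp_pos _) h]
  refine le_trans (le_of_eq ?_) (Real.add_one_le_exp _)
  field_simp
  ring

lemma quarter_exp_le_iSup_errorProb {K n : ℕ} [NeZero K] (hK : 2 ≤ K) {ρ : ℝ} (hρ : ρ ^ 2 < 1)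
    (hcov : (baseCov K ρ).PosSemidef) (A : Strategy K n) :
    1 / 4 * Real.exp (-(n * (ρ ^ 2 / (1 - ρ ^ 2)))) ≤ ⨆ m : Fin K, errorProb A ρ m := by
  have hsup (m : Fin K) : errorProb A ρ m ≤ ⨆ m : Fin K, errorProb A ρ m :=
    le_ciSup (f := fun m => errorProb A ρ m) (Set.finite_range _).bddAbove m
  have hne : (⟨0, by omega⟩ : Fin K) ≠ ⟨1, by omega⟩ := by simp
  have hsum := pow_div_two_le_errorProb_add hρ hcov A hne
  have hexp : Real.exp (-(n * (ρ ^ 2 / (1 - ρ ^ 2)))) ≤ (1 - ρ ^ 2) ^ n := by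
    rw [← mul_neg, Real.exp_nat_mul]
    exact pow_le_pow_left₀ (Real.exp_pos _).le (exp_neg_div_le_one_sub hρ) n
  linarith [hsup ⟨0, by omega⟩, hsup ⟨1, by omega⟩]

end CorrelatedBandit

theorem theorem3 (K n : ℕ) [NeZero K] (hK : 3 ≤ K) (hn : 1 ≤ n) (ρ u : ℝ)
    (hρ : ρ ^ 2 ≤ CorrelatedBandit.UB K)
    (hcov : (CorrelatedBandit.baseCov K ρ).PosSemidef)
    (hu : ∀ i, CorrelatedBandit.baseCov K ρ i i ≤ u)
    (A : CorrelatedBandit.Strategy K n) :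
    1 / 6 * Real.exp
        (-(6 * n * K / CorrelatedBandit.Hlb K ρ)
          - (K.choose 2 : ℝ) * n * CorrelatedBandit.epsTilde K ρ u n)
      ≤ ⨆ m : Fin K, CorrelatedBandit.errorProb A ρ m := by
  have hr := (CorrelatedBandit.one_le_sq_one_sub hK hρ).1
  have hu0 : 0 ≤ u := by
    have := hu 0
    rw [CorrelatedBandit.baseCov_self] at this
    linarith
  refine le_trans ?_ (CorrelatedBandit.quarter_exp_le_iSup_errorProb (by omega) hr hcov A)
  have hH := CorrelatedBandit.div_one_sub_le_div_Hlb hK hρ hcov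
  have hε : 0 ≤ (K.choose 2 : ℝ) * n * CorrelatedBandit.epsTilde K ρ u n :=
    mul_nonneg (by positivity) (CorrelatedBandit.epsTilde_nonneg ρ hu0 n)
  have h0 : 0 ≤ ρ ^ 2 / (1 - ρ ^ 2) := div_nonneg (sq_nonneg ρ) (by linarith)
  have hle : n * (ρ ^ 2 / (1 - ρ ^ 2)) ≤ 6 * n * K / CorrelatedBandit.Hlb K ρ := by
    calc n * (ρ ^ 2 / (1 - ρ ^ 2)) ≤ 6 * n * (ρ ^ 2 / (1 - ρ ^ 2)) := by nlinarith
      _ ≤ 6 * n * (K / CorrelatedBandit.Hlb K ρ) := by gcongr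
      _ = _ := by ring
  gcongr
  · norm_num
  · linarith
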